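/- Let $M$ be a complete metric space with a distinguished base point $0\in M$. For a metric space $N$ with base point $0$, let $\mathrm{Lip}_0(N)$ be the Banach space of Lipschitz functions $f:N\to\mathbb{R}$ with $f(0)=0$, normed by the best Lipschitz constant, and let the Lipschitz-free space $\mathcal{F}(N)$ be the closed linear span in $\mathrm{Lip}_0(N)^*$ of the evaluation functionals $\delta(x):f\mapsto f(x)$, $x\in N$. A subset $\Gamma$ of a real Banach space $X$ is a (V$^*$)-set if $\lim_{n\to\infty}\sup_{x\in\Gamma}|\langle x,x_n^*\rangle|=0$ for every sequence $(x_n^*)$ in $X^*$ such that $\sum_n|\langle x^{**},x_n^*\rangle|<\infty$ for all $x^{**}\in X^{**}$; and $X$ has property (V$^*$) if the weak closure of every (V$^*$)-set in $X$ is weakly compact. Theorem A. Property (V$^*$) is locally determined for Lipschitz-free spaces: if every point $x\in M$ has a neighborhood $U$ such that $\mathcal{F}(\overline{U}\cup\{0\})$ has property (V$^*$), then $\mathcal{F}(M)$ has property (V$^*$). -/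

import Mathlib

open Filter Topology

noncomputable section

/-! ### The space of Lipschitz functions vanishing at the base point -/

/-- The real-valued Lipschitz functions on `M` vanishing at the base point `o`, as a linear
subspace of all functions. -/
def lipZeroSubmodule (M : Type*) [MetricSpace M] (o : M) : Submodule ℝ (M → ℝ) where
  carrier := {f | (∃ K : NNReal, LipschitzWith K f) ∧ f o = 0}
  add_mem' := by
    rintro f g ⟨⟨K, hK⟩, hf⟩ ⟨⟨L, hL⟩, hg⟩
    exact ⟨⟨K + L, hK.add hL⟩, by simp [hf, hg]⟩
  zero_mem' := ⟨⟨0, LipschitzWith.const 0⟩, rfl⟩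
  smul_mem' := by
    rintro c f ⟨⟨K, hK⟩, hf⟩
    refine ⟨⟨‖c‖₊ * K, ?_⟩, by simp [hf]⟩
    exact (lipschitzWith_smul c).comp hK

/-- The space `Lip₀(M)` of real-valued Lipschitz functions on the metric space `M` with base
point `o` that vanish at `o`. It is a type of its own, so that it carries the topology of the
Lipschitz norm and not that of pointwise convergence. -/
def LipZero (M : Type*) [MetricSpace M] (o : M) : Type _ := ↥(lipZeroSubmodule M o)

namespace LipZero

variable {M : Type*} [MetricSpace M] {o : M}

instance : AddCommGroup (LipZero M o) := inferInstanceAs (AddCommGroup ↥(lipZeroSubmodule M o))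

instance : Module ℝ (LipZero M o) := inferInstanceAs (Module ℝ ↥(lipZeroSubmodule M o))

instance : FunLike (LipZero M o) M ℝ where
  coe f := f.1
  coe_injective _ _ h := Subtype.ext h

/-- The Lipschitz norm `Lip(f) = sup |f x - f y| / d(x, y)`. The pairs with `x = y` contribute
the value `0`. -/
instance : Norm (LipZero M o) where
  norm f := ⨆ p : M × M, |f p.1 - f p.2| / dist p.1 p.2

theorem norm_def (f : LipZero M o) : ‖f‖ = ⨆ p : M × M, |f p.1 - f p.2| / dist p.1 p.2 := rfl

theorem add_apply (f g : LipZero M o) (x : M) : (f + g) x = f x + g x := rfl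

theorem smul_apply (c : ℝ) (f : LipZero M o) (x : M) : (c • f) x = c * f x := rfl

theorem zero_apply (x : M) : (0 : LipZero M o) x = 0 := rfl

theorem map_base (f : LipZero M o) : f o = 0 := f.2.2

theorem bddAbove_slopes (f : LipZero M o) :
    BddAbove (Set.range fun p : M × M => |f p.1 - f p.2| / dist p.1 p.2) := by
  obtain ⟨K, hK⟩ := f.2.1
  refine ⟨K, ?_⟩
  rintro _ ⟨p, rfl⟩
  refine div_le_of_le_mul₀ dist_nonneg K.2 ?_
  have h := hK.dist_le_mul p.1 p.2
  rw [Real.dist_eq] at h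
  exact h

theorem norm_nonneg_aux (f : LipZero M o) : 0 ≤ ‖f‖ :=
  Real.iSup_nonneg fun _ => div_nonneg (abs_nonneg _) dist_nonneg

theorem abs_sub_le (f : LipZero M o) (x y : M) : |f x - f y| ≤ ‖f‖ * dist x y := by
  rcases eq_or_ne x y with rfl | h
  · simp
  · rw [← div_le_iff₀ (dist_pos.2 h)]
    exact le_ciSup f.bddAbove_slopes (x, y)

theorem norm_le_of {f : LipZero M o} {C : ℝ} (hC : 0 ≤ C)
    (h : ∀ x y, |f x - f y| ≤ C * dist x y) : ‖f‖ ≤ C :=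
  Real.iSup_le (fun p => div_le_of_le_mul₀ dist_nonneg hC (h p.1 p.2)) hC

theorem normedSpaceCore : NormedSpace.Core ℝ (LipZero M o) where
  norm_nonneg := norm_nonneg_aux
  norm_smul c f := by
    rw [norm_def, norm_def, Real.norm_eq_abs, Real.mul_iSup_of_nonneg (abs_nonneg c)]
    congr 1
    funext p
    rw [smul_apply, smul_apply, ← mul_sub, abs_mul, mul_div_assoc]
  norm_triangle f g := by
    refine norm_le_of (add_nonneg (norm_nonneg_aux f) (norm_nonneg_aux g)) fun x y => ?_
    rw [add_apply, add_apply, add_sub_add_comm, add_mul]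
    exact (abs_add_le _ _).trans (add_le_add (abs_sub_le f x y) (abs_sub_le g x y))
  norm_eq_zero_iff f := by
    constructor
    · intro h
      refine DFunLike.ext _ _ fun x => ?_
      have hx := abs_sub_le f x o
      rw [h, zero_mul, map_base, sub_zero] at hx
      rw [zero_apply]
      exact abs_nonpos_iff.1 hx
    · rintro rfl
      exact le_antisymm (norm_le_of le_rfl fun x y => by simp [zero_apply]) (norm_nonneg_aux 0)

instance : NormedAddCommGroup (LipZero M o) := NormedAddCommGroup.ofCore normedSpaceCore

instance : NormedSpace ℝ (LipZero M o) := NormedSpace.ofCore normedSpaceCore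

/-- The evaluation functional `δ(x) : f ↦ f x`, an element of the dual of `Lip₀(M)`. -/
def delta (o x : M) : StrongDual ℝ (LipZero M o) :=
  LinearMap.mkContinuous
    { toFun := fun f => f x
      map_add' := fun f g => add_apply f g x
      map_smul' := fun c f => smul_apply c f x } (dist x o) fun f => by
    have h := abs_sub_le f x o
    rw [map_base, sub_zero, mul_comm] at h
    exact h

end LipZero

/-- The Lipschitz-free space `F(M)` over the metric space `M` with base point `o`: the closed
linear span of the evaluation functionals in the dual of `Lip₀(M)`, with the dual norm. -/
abbrev LipschitzFree (M : Type*) [MetricSpace M] (o : M) : Type _ :=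
  ↥(Submodule.span ℝ (Set.range (LipZero.delta o))).topologicalClosure

/-! ### Property (V*) -/

/-- The formal series `∑ xₙ` is weakly unconditionally Cauchy: `∑ |φ(xₙ)| < ∞` for every `φ` in
the dual space. -/
def IsWUC {X : Type*} [NormedAddCommGroup X] [NormedSpace ℝ X] (x : ℕ → X) : Prop :=
  ∀ φ : StrongDual ℝ X, Summable fun n => |φ (x n)|

/-- `Γ` is a (V*)-set with respect to `X`: for every weakly unconditionally Cauchy series
`∑ φₙ` in the dual of `X`, `sup_{x ∈ Γ} |φₙ(x)|` (a supremum in `[0, ∞]`) tends to `0`. -/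
def IsVStarSet {X : Type*} [NormedAddCommGroup X] [NormedSpace ℝ X] (Γ : Set X) : Prop :=
  ∀ φ : ℕ → StrongDual ℝ X, IsWUC φ →
    Tendsto (fun n => ⨆ x ∈ Γ, ENNReal.ofReal |φ n x|) atTop (𝓝 0)

/-- `Γ` is relatively weakly compact: its closure in the weak topology is weakly compact. -/
def IsRelWeaklyCompact {X : Type*} [NormedAddCommGroup X] [NormedSpace ℝ X] (Γ : Set X) : Prop :=
  IsCompact (closure (toWeakSpace ℝ X '' Γ))

/-- Pełczyński's property (V*) of a Banach space `X`: every (V*)-set with respect to `X` is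
relatively weakly compact. -/
def HasPropertyVStar (X : Type*) [NormedAddCommGroup X] [NormedSpace ℝ X] : Prop :=
  ∀ Γ : Set X, IsVStarSet Γ → IsRelWeaklyCompact Γ

end

/-! Multiplication by a suitable function acts on `Lip₀(M)`, and its preadjoint reweights `F(M)`.
The sets `A` that carry a weight equal to `1` on `A` and sending (V*)-sets to relatively weakly
compact sets form an ideal (`IsVStarLocus`). By the local hypothesis every point has a ball in this
ideal (`isVStarLocus_ball`).

A (V*)-set `Γ` is tight: up to a small error it is concentrated near a finite set. Otherwise one
could build bounded, disjointly supported Lipschitz functions, hence a weakly unconditionally Cauchy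
series, that do not tend to zero uniformly on `Γ` (`exists_cutoff_of_isVStarSet`). Iterating with
summable errors concentrates `Γ`, up to `ε`, on each of a decreasing sequence of sets `A n`, whose
points are close to finite sets at `n` successive scales.

No single `A n` need be totally bounded, but an ultrafilter containing all of them converges, by
completeness. If no `A n` were in the ideal, some such ultrafilter would avoid the ideal, and yet
contain a neighborhood of its limit that belongs to it. So some `A n` is in the ideal, `Γ` is
`ε`-close to a relatively weakly compact set, and Grothendieck's criterion
(`IsRelWeaklyCompact.of_approx`) concludes. -/

noncomputable section

/-! ### Relatively weakly compact sets -/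

section WeakCompactness

variable {X Y : Type*} [NormedAddCommGroup X] [NormedSpace ℝ X]
  [NormedAddCommGroup Y] [NormedSpace ℝ Y]

instance WeakSpace.instT2Space : T2Space (WeakSpace ℝ X) :=
  (NormedSpace.isEmbedding_inclusionInDoubleDualWeak ℝ X).t2Space

theorem WeakSpace.tendsto_iff_forall_dual {α : Type*} {l : Filter α} {f : α → WeakSpace ℝ X}
    {x : WeakSpace ℝ X} :
    Tendsto f l (𝓝 x) ↔ ∀ φ : StrongDual ℝ X,
      Tendsto (fun i => φ ((toWeakSpace ℝ X).symm (f i))) l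
        (𝓝 (φ ((toWeakSpace ℝ X).symm x))) := by
  refine WeakBilin.tendsto_iff_forall_eval_tendsto (topDualPairing ℝ X).flip ?_
  intro a b hab
  refine (NormedSpace.inclusionInDoubleDualLi ℝ (E := X)).injective ?_
  ext φ
  exact DFunLike.congr_fun hab φ

theorem isClosed_toWeakSpace_closedBall (r : ℝ) :
    IsClosed (toWeakSpace ℝ X '' Metric.closedBall 0 r) := by
  have h := (convex_closedBall (0 : X) r).toWeakSpace_closure (𝕜 := ℝ)
  rw [Metric.isClosed_closedBall.closure_eq] at h
  rw [h]
  exact isClosed_closure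

theorem IsRelWeaklyCompact.of_subset_isCompact {Γ : Set X} {K : Set (WeakSpace ℝ X)}
    (hK : IsCompact K) (h : toWeakSpace ℝ X '' Γ ⊆ K) : IsRelWeaklyCompact Γ :=
  hK.of_isClosed_subset isClosed_closure (closure_minimal h hK.isClosed)

theorem IsRelWeaklyCompact.image {Γ : Set X} (h : IsRelWeaklyCompact Γ) (T : X →L[ℝ] Y) :
    IsRelWeaklyCompact (T '' Γ) := by
  refine .of_subset_isCompact (IsCompact.image h (WeakSpace.map T).continuous) ?_
  rintro _ ⟨_, ⟨x, hx, rfl⟩, rfl⟩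
  exact ⟨toWeakSpace ℝ X x, subset_closure ⟨x, hx, rfl⟩, rfl⟩

open scoped Pointwise in
theorem IsRelWeaklyCompact.of_forall_add {Γ Γ₁ Γ₂ : Set X} (h₁ : IsRelWeaklyCompact Γ₁)
    (h₂ : IsRelWeaklyCompact Γ₂) (h : ∀ x ∈ Γ, ∃ a ∈ Γ₁, ∃ b ∈ Γ₂, x = a + b) :
    IsRelWeaklyCompact Γ := by
  refine .of_subset_isCompact (IsCompact.add h₁ h₂) ?_
  rintro _ ⟨x, hx, rfl⟩
  obtain ⟨a, ha, b, hb, rfl⟩ := h x hx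
  exact ⟨_, subset_closure ⟨a, ha, rfl⟩, _, subset_closure ⟨b, hb, rfl⟩, (map_add _ _ _).symm⟩

-- Grothendieck's criterion. Along an ultrafilter on the weak closure of `Γ`, the approximants at
-- each precision converge weakly by compactness. Their limits are Cauchy in norm, and the limit of
-- these limits is the weak limit of the ultrafilter.
open scoped Pointwise in
theorem IsRelWeaklyCompact.of_approx [CompleteSpace X] {Γ : Set X}
    (h : ∀ ε > 0, ∃ Γ' : Set X, IsRelWeaklyCompact Γ' ∧ ∀ x ∈ Γ, ∃ a ∈ Γ', ‖x - a‖ ≤ ε) :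
    IsRelWeaklyCompact Γ := by
  set e := toWeakSpace ℝ X
  have key : ∀ ε > 0, ∃ K : Set (WeakSpace ℝ X), IsCompact K ∧
      ∀ x ∈ closure (e '' Γ), ∃ a ∈ K, ‖e.symm x - e.symm a‖ ≤ ε := by
    intro ε hε
    obtain ⟨Γ', hΓ', hΓ⟩ := h ε hε
    refine ⟨_, hΓ', ?_⟩
    -- Weakly compact plus weakly closed is weakly closed, so the approximation passes from `Γ` to
    -- its weak closure.
    have hcl : IsClosed (closure (e '' Γ') + e '' Metric.closedBall 0 ε) :=
      (isClosed_toWeakSpace_closedBall ε).add_left_of_isCompact hΓ'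
    have hsub : closure (e '' Γ) ⊆ closure (e '' Γ') + e '' Metric.closedBall 0 ε := by
      refine closure_minimal ?_ hcl
      rintro _ ⟨x, hx, rfl⟩
      obtain ⟨a, ha, hxa⟩ := hΓ x hx
      refine ⟨e a, subset_closure ⟨a, ha, rfl⟩, e (x - a), ⟨x - a, by simpa using hxa, rfl⟩, ?_⟩
      change e a + e (x - a) = e x
      rw [← map_add, add_sub_cancel]
    intro x hx
    obtain ⟨a, ha, _, ⟨b, hb, rfl⟩, rfl⟩ := hsub hx
    refine ⟨a, ha, ?_⟩
    simpa using hb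
  set η : ℕ → ℝ := fun n => 1 / ((n : ℝ) + 1)
  have hη : ∀ n, 0 < η n := fun n => by positivity
  have hη0 : Tendsto η atTop (𝓝 0) := tendsto_one_div_add_atTop_nhds_zero_nat
  choose K hK hKa using fun n => key (η n) (hη n)
  refine isCompact_iff_ultrafilter_le_nhds.2 fun u hu => ?_
  have hmem : closure (e '' Γ) ∈ u := le_principal_iff.1 hu
  have ha : ∀ n, ∃ a : WeakSpace ℝ X → WeakSpace ℝ X, ∀ x ∈ closure (e '' Γ),
      a x ∈ K n ∧ ‖e.symm x - e.symm (a x)‖ ≤ η n := by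
    intro n
    choose! a ha using hKa n
    exact ⟨a, ha⟩
  choose a ha using ha
  have hlim : ∀ n, ∃ y : X, Tendsto (a n) u (𝓝 (e y)) := by
    intro n
    obtain ⟨y, -, hy⟩ := isCompact_iff_ultrafilter_le_nhds.1 (hK n) (u.map (a n))
      (le_principal_iff.2 (Ultrafilter.mem_map.2
        (mem_of_superset hmem fun x hx => (ha n x hx).1)))
    exact ⟨e.symm y, by rw [e.apply_symm_apply]; exact hy⟩
  choose y hy using hlim
  -- Closed balls are weakly closed, so norm bounds on differences survive the weak limits.
  have hdist : ∀ n m, ‖y n - y m‖ ≤ η n + η m := by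
    intro n m
    have h1 : Tendsto (fun x => a n x - a m x) u (𝓝 (e (y n) - e (y m))) := (hy n).sub (hy m)
    have h2 := (isClosed_toWeakSpace_closedBall (X := X) (η n + η m)).mem_of_tendsto h1 (by
      filter_upwards [hmem] with x hx
      refine ⟨e.symm (a n x) - e.symm (a m x), ?_, by simp [e]⟩
      rw [mem_closedBall_zero_iff]
      have h3 := norm_sub_le (e.symm x - e.symm (a m x)) (e.symm x - e.symm (a n x))
      rw [sub_sub_sub_cancel_left] at h3
      linarith [(ha n x hx).2, (ha m x hx).2])
    obtain ⟨z, hz, hze⟩ := h2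
    rw [← map_sub] at hze
    rw [← e.injective hze]
    simpa using hz
  have hcau : CauchySeq y := by
    refine cauchySeq_of_le_tendsto_0 (fun n => η n + η n) (fun n m N hn hm => ?_)
      (by simpa using hη0.add hη0)
    rw [dist_eq_norm]
    exact (hdist n m).trans (add_le_add (Nat.one_div_le_one_div hn) (Nat.one_div_le_one_div hm))
  obtain ⟨z, hz⟩ := cauchySeq_tendsto_of_complete hcau
  have hyz : ∀ n, ‖y n - z‖ ≤ η n := by
    intro n
    have h1 : Tendsto (fun m => ‖y n - y m‖) atTop (𝓝 ‖y n - z‖) :=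
      (tendsto_const_nhds.sub hz).norm
    have h2 : Tendsto (fun m => η n + η m) atTop (𝓝 (η n)) := by
      simpa using hη0.const_add (η n)
    exact le_of_tendsto_of_tendsto' h1 h2 (hdist n)
  have huz : (u : Filter (WeakSpace ℝ X)) ≤ 𝓝 (e z) := by
    change Tendsto id (u : Filter (WeakSpace ℝ X)) (𝓝 (e z))
    rw [WeakSpace.tendsto_iff_forall_dual]
    intro φ
    rw [Metric.tendsto_nhds]
    intro ε hε
    obtain ⟨n, hn⟩ : ∃ n, ‖φ‖ * (2 * η n) < ε / 2 := by
      have : Tendsto (fun n => ‖φ‖ * (2 * η n)) atTop (𝓝 0) := by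
        simpa using (hη0.const_mul 2).const_mul ‖φ‖
      exact (this.eventually_lt_const (half_pos hε)).exists
    have h1 := Metric.tendsto_nhds.1 (WeakSpace.tendsto_iff_forall_dual.1 (hy n) φ) (ε / 2)
      (half_pos hε)
    filter_upwards [h1, hmem] with x hx hxm
    have h2 : φ (e.symm x) - φ z = (φ (e.symm (a n x)) - φ (y n)) +
        φ ((e.symm x - e.symm (a n x)) + (y n - z)) := by
      simp only [map_add, map_sub]; ring
    have h3 : ‖φ ((e.symm x - e.symm (a n x)) + (y n - z))‖ ≤ ‖φ‖ * (2 * η n) := by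
      refine (φ.le_opNorm _).trans (mul_le_mul_of_nonneg_left ?_ (norm_nonneg _))
      refine (norm_add_le _ _).trans ?_
      linarith [(ha n x hxm).2, hyz n]
    rw [dist_eq_norm] at hx ⊢
    change ‖φ (e.symm x) - φ z‖ < ε
    change ‖φ (e.symm (a n x)) - φ (y n)‖ < ε / 2 at hx
    rw [h2]
    exact (norm_add_le _ _).trans_lt (by linarith)
  exact ⟨e z, isClosed_iff_ultrafilter.1 isClosed_closure _ u huz hmem, huz⟩

end WeakCompactness

/-! ### (V*)-sets -/

section VStar

variable {X Y : Type*} [NormedAddCommGroup X] [NormedSpace ℝ X]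
  [NormedAddCommGroup Y] [NormedSpace ℝ Y]

theorem IsWUC.map {x : ℕ → X} (hx : IsWUC x) (T : X →L[ℝ] Y) : IsWUC fun n => T (x n) :=
  fun φ => hx (φ.comp T)

theorem IsVStarSet.image {Γ : Set X} (h : IsVStarSet Γ) (T : X →L[ℝ] Y) :
    IsVStarSet (T '' Γ) := by
  intro φ hφ
  have h1 := h _ (hφ.map (ContinuousLinearMap.precomp ℝ T))
  refine h1.congr fun n => ?_
  rw [iSup_image]
  rfl

/-- Taking for `c` the signs of `φ (x n)` turns a partial sum of absolute values into one value of
`φ`. -/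
theorem isWUC_of_norm_sum_le {x : ℕ → X} (C : ℝ)
    (h : ∀ (s : Finset ℕ) (c : ℕ → ℝ), (∀ n, |c n| ≤ 1) → ‖∑ n ∈ s, c n • x n‖ ≤ C) :
    IsWUC x := by
  intro φ
  refine summable_of_sum_le (fun _ => abs_nonneg _) (c := ‖φ‖ * C) fun s => ?_
  have h1 : ∑ n ∈ s, |φ (x n)| = φ (∑ n ∈ s, (SignType.sign (φ (x n)) : ℝ) • x n) := by
    simp [map_sum, sign_mul_self]
  rw [h1]
  refine (le_abs_self _).trans ((φ.le_opNorm _).trans ?_)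
  refine mul_le_mul_of_nonneg_left (h s _ fun n => ?_) (norm_nonneg _)
  rcases lt_trichotomy (φ (x n)) 0 with h | h | h <;> simp [h]

theorem IsVStarSet.exists_forall_lt {Γ : Set X} (h : IsVStarSet Γ) {φ : ℕ → StrongDual ℝ X}
    (hφ : IsWUC φ) {ε : ℝ} (hε : 0 < ε) : ∃ n, ∀ x ∈ Γ, |φ n x| < ε := by
  obtain ⟨n, hn⟩ := ((h φ hφ).eventually_lt_const (ENNReal.ofReal_pos.2 hε)).exists
  refine ⟨n, fun x hx => ?_⟩
  exact (ENNReal.ofReal_lt_ofReal_iff hε).1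
    ((le_iSup₂ (f := fun x (_ : x ∈ Γ) => ENNReal.ofReal |φ n x|) x hx).trans_lt hn)

/-- With `Y = F(M)` and `X = Lip₀(M)`, `i.flip` carries a series of Lipschitz functions into the
dual of `F(M)`; the identification of that dual with `Lip₀(M)` is not needed. -/
theorem IsVStarSet.exists_forall_pairing_lt {Γ : Set Y} (h : IsVStarSet Γ)
    (i : Y →L[ℝ] StrongDual ℝ X) {g : ℕ → X} (hg : IsWUC g) {ε : ℝ} (hε : 0 < ε) :
    ∃ n, ∀ y ∈ Γ, |i y (g n)| < ε :=
  h.exists_forall_lt (hg.map i.flip) hε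

end VStar

namespace LipZero

variable {M N : Type*} [MetricSpace M] [MetricSpace N] {o : M} {p : N}

/-! ### Operators on Lipschitz-free spaces -/

/-- The closed linear span of the evaluation functionals, as a submodule of the dual. -/
abbrev freeSubmodule (M : Type*) [MetricSpace M] (o : M) :
    Submodule ℝ (StrongDual ℝ (LipZero M o)) :=
  (Submodule.span ℝ (Set.range (delta o))).topologicalClosure

theorem delta_mem_freeSubmodule (o x : M) : delta o x ∈ freeSubmodule M o :=
  Submodule.le_topologicalClosure _ (Submodule.subset_span ⟨x, rfl⟩)

/-- Precomposition is continuous and the target is a closed subspace, so evaluations suffice. -/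
theorem comp_mem_freeSubmodule (A : LipZero M o →L[ℝ] LipZero N p)
    (hA : ∀ y, (delta p y).comp A ∈ freeSubmodule M o) {ν : StrongDual ℝ (LipZero N p)}
    (hν : ν ∈ freeSubmodule N p) : ν.comp A ∈ freeSubmodule M o := by
  have hcl : IsClosed ((freeSubmodule M o).comap
      (ContinuousLinearMap.precomp ℝ A).toLinearMap : Set (StrongDual ℝ (LipZero N p))) :=
    (Submodule.isClosed_topologicalClosure _).preimage
      (ContinuousLinearMap.precomp ℝ A).continuous
  refine Submodule.topologicalClosure_minimal _ (Submodule.span_le.2 ?_) hcl hν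
  rintro _ ⟨y, rfl⟩
  exact hA y

/-- The operator between Lipschitz-free spaces whose adjoint is `A`, if there is one. -/
def preadjoint (A : LipZero M o →L[ℝ] LipZero N p)
    (hA : ∀ y, (delta p y).comp A ∈ freeSubmodule M o) :
    LipschitzFree N p →L[ℝ] LipschitzFree M o :=
  ((ContinuousLinearMap.precomp ℝ A).comp (freeSubmodule N p).subtypeL).codRestrict
    (freeSubmodule M o) fun ν => comp_mem_freeSubmodule A hA ν.2

/-- An element of the span depends only on the values of `f` at finitely many points. -/
theorem exists_finset_approx (μ : LipschitzFree M o) {η : ℝ} (hη : 0 < η) :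
    ∃ (S : Finset M) (ν : StrongDual ℝ (LipZero M o)), ‖μ.1 - ν‖ < η ∧
      ∀ f : LipZero M o, (∀ x ∈ S, f x = 0) → ν f = 0 := by
  classical
  obtain ⟨ν, hν, hd⟩ := Metric.mem_closure_iff.1 μ.2 η hη
  rw [dist_eq_norm] at hd
  suffices ∃ S : Finset M, ∀ f : LipZero M o, (∀ x ∈ S, f x = 0) → ν f = 0 by
    obtain ⟨S, hS⟩ := this
    exact ⟨S, ν, hd, hS⟩
  clear hd
  induction hν using Submodule.span_induction with
  | mem ν h =>
    obtain ⟨x, rfl⟩ := h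
    exact ⟨{x}, fun f hf => hf x (Finset.mem_singleton_self x)⟩
  | zero => exact ⟨∅, fun f _ => rfl⟩
  | add ν₁ ν₂ _ _ h₁ h₂ =>
    obtain ⟨S₁, h₁⟩ := h₁
    obtain ⟨S₂, h₂⟩ := h₂
    refine ⟨S₁ ∪ S₂, fun f hf => ?_⟩
    rw [_root_.add_apply, h₁ f fun x hx => hf x (Finset.mem_union_left _ hx),
      h₂ f fun x hx => hf x (Finset.mem_union_right _ hx), add_zero]
  | smul c ν _ h =>
    obtain ⟨S, h⟩ := h
    refine ⟨S, fun f hf => ?_⟩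
    rw [_root_.smul_apply, h f hf, smul_zero]

/-! ### Disjointly supported Lipschitz functions -/

theorem sum_apply {ι : Type*} (s : Finset ι) (g : ι → LipZero M o) (x : M) :
    (∑ i ∈ s, g i) x = ∑ i ∈ s, g i x := by
  have h : ∀ f : LipZero M o, f x = delta o x f := fun _ => rfl
  simp only [h, map_sum]

/-- At each of `x` and `y` at most one `g n` is nonzero, so at most two terms contribute to the
difference. -/
theorem norm_sum_le_of_disjoint {g : ℕ → LipZero M o} {D : ℝ} (hg : ∀ n, ‖g n‖ ≤ D)
    (hdisj : ∀ m n x, m < n → g m x ≠ 0 → g n x = 0) (s : Finset ℕ) (c : ℕ → ℝ)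
    (hc : ∀ n, |c n| ≤ 1) : ‖∑ n ∈ s, c n • g n‖ ≤ 2 * D := by
  have hD : 0 ≤ D := (norm_nonneg _).trans (hg 0)
  refine norm_le_of (by positivity) fun x y => ?_
  have hcard : ∀ z, (s.filter fun n => g n z ≠ 0).card ≤ 1 := by
    intro z
    refine Finset.card_le_one.2 fun m hm n hn => ?_
    rw [Finset.mem_filter] at hm hn
    by_contra hne
    rcases lt_or_gt_of_ne hne with h | h
    · exact hn.2 (hdisj m n z h hm.2)
    · exact hm.2 (hdisj n m z h hn.2)
  have hcard2 : (s.filter fun n => g n x ≠ 0 ∨ g n y ≠ 0).card ≤ 2 := by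
    rw [Finset.filter_or]
    exact (Finset.card_union_le _ _).trans (add_le_add (hcard x) (hcard y))
  have hterm : ∀ n, |c n * g n x - c n * g n y| ≤ D * dist x y := by
    intro n
    rw [← mul_sub, abs_mul]
    calc |c n| * |g n x - g n y| ≤ 1 * (‖g n‖ * dist x y) :=
          mul_le_mul (hc n) (abs_sub_le _ _ _) (abs_nonneg _) zero_le_one
      _ ≤ D * dist x y := by rw [one_mul]; gcongr; exact hg n
  have hzero : ∀ n ∈ s, c n * g n x - c n * g n y ≠ 0 → g n x ≠ 0 ∨ g n y ≠ 0 := by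
    intro n _ h
    contrapose! h
    rw [h.1, h.2]
    simp
  simp only [sum_apply, smul_apply]
  rw [← Finset.sum_sub_distrib, ← Finset.sum_filter_of_ne hzero]
  refine (Finset.abs_sum_le_sum_abs _ _).trans
    ((Finset.sum_le_card_nsmul _ _ _ fun n _ => hterm n).trans ?_)
  rw [nsmul_eq_mul, mul_assoc]
  have : ((s.filter fun n => g n x ≠ 0 ∨ g n y ≠ 0).card : ℝ) ≤ 2 := by exact_mod_cast hcard2
  have : 0 ≤ D * dist x y := by positivity
  gcongr

theorem _root_.IsVStarSet.exists_forall_apply_lt {Γ : Set (LipschitzFree M o)}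
    (h : IsVStarSet Γ) {g : ℕ → LipZero M o} (hg : IsWUC g) {ε : ℝ} (hε : 0 < ε) :
    ∃ n, ∀ μ ∈ Γ, |μ.1 (g n)| < ε :=
  h.exists_forall_pairing_lt (freeSubmodule M o).subtypeL hg hε

theorem isWUC_of_disjoint {g : ℕ → LipZero M o} {D : ℝ} (hg : ∀ n, ‖g n‖ ≤ D)
    (hdisj : ∀ m n x, m < n → g m x ≠ 0 → g n x = 0) : IsWUC g :=
  isWUC_of_norm_sum_le (2 * D) (norm_sum_le_of_disjoint hg hdisj)

/-! ### Multiplication operators -/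

/-- `L` is the operator of multiplication by the function `h`. -/
def IsMul (L : LipZero M o →L[ℝ] LipZero M o) (h : M → ℝ) : Prop :=
  ∀ f x, L f x = h x * f x

theorem IsMul.comp {L L' : LipZero M o →L[ℝ] LipZero M o} {h h' : M → ℝ} (H : IsMul L h)
    (H' : IsMul L' h') : IsMul (L.comp L') (h * h') := fun f x => by
  rw [ContinuousLinearMap.comp_apply, H, H', Pi.mul_apply, mul_assoc]

theorem IsMul.add {L L' : LipZero M o →L[ℝ] LipZero M o} {h h' : M → ℝ} (H : IsMul L h)
    (H' : IsMul L' h') : IsMul (L + L') (h + h') := fun f x => by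
  rw [_root_.add_apply, add_apply, H, H', Pi.add_apply, add_mul]

theorem sub_apply (f g : LipZero M o) (x : M) : (f - g) x = f x - g x := rfl

theorem IsMul.sub {L L' : LipZero M o →L[ℝ] LipZero M o} {h h' : M → ℝ} (H : IsMul L h)
    (H' : IsMul L' h') : IsMul (L - L') (h - h') := fun f x => by
  rw [_root_.sub_apply, sub_apply, H, H', Pi.sub_apply, sub_mul]

theorem IsMul.id : IsMul (ContinuousLinearMap.id ℝ (LipZero M o)) 1 := fun f x => by
  simp

theorem IsMul.zero : IsMul (0 : LipZero M o →L[ℝ] LipZero M o) 0 := fun f x => by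
  simp [zero_apply]

theorem IsMul.delta_comp_mem {L : LipZero M o →L[ℝ] LipZero M o} {h : M → ℝ} (H : IsMul L h)
    (x : M) : (delta o x).comp L ∈ freeSubmodule M o := by
  have : (delta o x).comp L = h x • delta o x := ContinuousLinearMap.ext fun f => H f x
  rw [this]
  exact Submodule.smul_mem _ _ (delta_mem_freeSubmodule o x)

/-- The weighting operator on the Lipschitz-free space, preadjoint to a multiplication. -/
def IsMul.weight {L : LipZero M o →L[ℝ] LipZero M o} {h : M → ℝ} (H : IsMul L h) :
    LipschitzFree M o →L[ℝ] LipschitzFree M o :=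
  preadjoint L H.delta_comp_mem

/-- The Lipschitz function with given values and Lipschitz constant. -/
def ofLipschitz (g : M → ℝ) (K : ℝ) (hg : ∀ x y, |g x - g y| ≤ K * dist x y) (ho : g o = 0) :
    LipZero M o :=
  ⟨g, ⟨K.toNNReal, LipschitzWith.of_dist_le_mul fun x y =>
    (hg x y).trans (mul_le_mul_of_nonneg_right (Real.le_coe_toNNReal K) dist_nonneg)⟩, ho⟩

/-- A linear operation on functions that is bounded for the Lipschitz norm, as an operator. -/
def mkOperator (A : (N → ℝ) →ₗ[ℝ] M → ℝ) (C : ℝ) (hC : 0 ≤ C)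
    (hA : ∀ (f : LipZero N p) (x y : M), |A f x - A f y| ≤ C * ‖f‖ * dist x y)
    (ho : ∀ f : LipZero N p, A f o = 0) : LipZero N p →L[ℝ] LipZero M o :=
  LinearMap.mkContinuous
    { toFun := fun f => ofLipschitz (A f) (C * ‖f‖) (hA f) (ho f)
      map_add' := fun f g => DFunLike.ext _ _ fun x => congrFun (A.map_add f g) x
      map_smul' := fun c f => DFunLike.ext _ _ fun x => congrFun (A.map_smul c f) x } C
    fun f => norm_le_of (mul_nonneg hC (norm_nonneg f)) (hA f)

theorem norm_mkOperator_le (A : (N → ℝ) →ₗ[ℝ] M → ℝ) {C : ℝ} (hC : 0 ≤ C)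
    (hA : ∀ (f : LipZero N p) (x y : M), |A f x - A f y| ≤ C * ‖f‖ * dist x y)
    (ho : ∀ f : LipZero N p, A f o = 0) : ‖mkOperator A C hC hA ho‖ ≤ C :=
  LinearMap.mkContinuous_norm_le _ hC _

/-- Product rule: since `f` vanishes at `o`, `|f x|` is at most `‖f‖ * dist x o`, so the variation
of `h` need only be controlled after multiplication by `dist x o`. -/
theorem abs_mul_sub_mul_le {h : M → ℝ} {C : ℝ} (h1 : ∀ x, |h x| ≤ 1)
    (hh : ∀ x y, dist x o * |h x - h y| ≤ C * dist x y) (f : LipZero M o) (x y : M) :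
    |h x * f x - h y * f y| ≤ (1 + C) * ‖f‖ * dist x y := by
  have h2 : h x * f x - h y * f y = h y * (f x - f y) + f x * (h x - h y) := by ring
  have h3 : |f x| ≤ ‖f‖ * dist x o := by
    simpa [map_base] using abs_sub_le f x o
  rw [h2]
  refine (abs_add_le _ _).trans ?_
  rw [abs_mul, abs_mul]
  have h4 : |h y| * |f x - f y| ≤ 1 * (‖f‖ * dist x y) :=
    mul_le_mul (h1 y) (abs_sub_le f x y) (abs_nonneg _) zero_le_one
  have h5 : |f x| * |h x - h y| ≤ ‖f‖ * (dist x o * |h x - h y|) := by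
    rw [← mul_assoc]
    exact mul_le_mul_of_nonneg_right h3 (abs_nonneg _)
  have h6 := mul_le_mul_of_nonneg_left (hh x y) (norm_nonneg f)
  linarith

theorem exists_isMul {h : M → ℝ} {C : ℝ} (hC : 0 ≤ C) (h1 : ∀ x, |h x| ≤ 1)
    (hh : ∀ x y, dist x o * |h x - h y| ≤ C * dist x y) :
    ∃ L : LipZero M o →L[ℝ] LipZero M o, IsMul L h ∧ ‖L‖ ≤ 1 + C :=
  ⟨mkOperator (LinearMap.mulLeft ℝ h) (1 + C) (by positivity)
    (fun f x y => abs_mul_sub_mul_le h1 hh f x y) (fun f => by simp [map_base]),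
    fun _ _ => rfl, norm_mkOperator_le _ _ _ _⟩

end LipZero

/-! ### Cutoff functions -/

/-- The truncation of a real number to the interval `[0, 1]`. -/
def unitClamp (t : ℝ) : ℝ := max 0 (min 1 t)

theorem unitClamp_nonneg (t : ℝ) : 0 ≤ unitClamp t := le_max_left _ _

theorem unitClamp_le_one (t : ℝ) : unitClamp t ≤ 1 := max_le zero_le_one (min_le_left _ _)

theorem abs_unitClamp_le_one (t : ℝ) : |unitClamp t| ≤ 1 := by
  rw [abs_of_nonneg (unitClamp_nonneg t)]
  exact unitClamp_le_one t

theorem unitClamp_eq_one {t : ℝ} (h : 1 ≤ t) : unitClamp t = 1 := by simp [unitClamp, h]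

theorem unitClamp_eq_zero {t : ℝ} (h : t ≤ 0) : unitClamp t = 0 :=
  max_eq_left ((min_le_right _ _).trans h)

theorem abs_unitClamp_sub_le (s t : ℝ) : |unitClamp s - unitClamp t| ≤ |s - t| := by
  have h : LipschitzWith 1 unitClamp := (LipschitzWith.id.const_min 1).const_max 0
  simpa [Real.dist_eq] using h.dist_le_mul s t

namespace LipZero

variable {M : Type*} [MetricSpace M] {o : M}

/-- The distance to `F ∪ {o}`, relative to the distance to the base point. -/
def relDist (o : M) (F : Finset M) (x : M) : ℝ :=
  Metric.infDist x (insert o (F : Set M)) / (1 + dist x o)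

theorem relDist_nonneg (o : M) (F : Finset M) (x : M) : 0 ≤ relDist o F x :=
  div_nonneg Metric.infDist_nonneg (by positivity)

theorem relDist_anti (o : M) {F G : Finset M} (h : F ⊆ G) (x : M) :
    relDist o G x ≤ relDist o F x := by
  refine div_le_div_of_nonneg_right ?_ (by positivity)
  exact Metric.infDist_le_infDist_of_subset (Set.insert_subset_insert (by exact_mod_cast h))
    ⟨o, Set.mem_insert _ _⟩

theorem relDist_eq_zero (o : M) {F : Finset M} {x : M} (hx : x ∈ F) : relDist o F x = 0 := by
  rw [relDist, Metric.infDist_zero_of_mem (Set.mem_insert_of_mem _ hx), zero_div]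

/-- The denominator `1 + dist x o` absorbs the factor `dist x o`, with a constant independent of
`F`. Including `o` in the set keeps the quotient at most `1`. -/
theorem dist_mul_abs_relDist_sub_le (o : M) (F : Finset M) (x y : M) :
    dist x o * |relDist o F x - relDist o F y| ≤ 2 * dist x y := by
  set a := Metric.infDist x (insert o (F : Set M))
  set b := Metric.infDist y (insert o (F : Set M))
  have hb0 : 0 ≤ b := Metric.infDist_nonneg
  have hab : |a - b| ≤ dist x y := by
    have h := (Metric.lipschitz_infDist_pt (insert o (F : Set M))).dist_le_mul x y
    simpa [Real.dist_eq] using h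
  have hb : b ≤ 1 + dist y o :=
    (Metric.infDist_le_dist_of_mem (Set.mem_insert _ _)).trans (by linarith)
  have hxy : |dist y o - dist x o| ≤ dist x y := by
    rw [dist_comm x y]
    exact abs_dist_sub_le y x o
  have hs : 0 < 1 + dist x o := by positivity
  have ht : 0 < 1 + dist y o := by positivity
  have h1 : relDist o F x - relDist o F y =
      ((a - b) + b / (1 + dist y o) * (dist y o - dist x o)) / (1 + dist x o) := by
    change a / (1 + dist x o) - b / (1 + dist y o) = _
    field_simp
    ring
  have h2 : |(a - b) + b / (1 + dist y o) * (dist y o - dist x o)| ≤ 2 * dist x y := by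
    refine (abs_add_le _ _).trans ?_
    rw [abs_mul, abs_of_nonneg (div_nonneg hb0 ht.le)]
    have h3 : b / (1 + dist y o) * |dist y o - dist x o| ≤ 1 * dist x y :=
      mul_le_mul ((div_le_one ht).2 hb) hxy (abs_nonneg _) zero_le_one
    linarith
  rw [h1, abs_div, abs_of_pos hs]
  calc dist x o * (|(a - b) + b / (1 + dist y o) * (dist y o - dist x o)| / (1 + dist x o))
      = dist x o / (1 + dist x o) *
        |(a - b) + b / (1 + dist y o) * (dist y o - dist x o)| := by ring
    _ ≤ 1 * (2 * dist x y) := by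
        refine mul_le_mul ((div_le_one hs).2 (by linarith)) h2 (abs_nonneg _) zero_le_one
    _ = _ := one_mul _

/-- A cutoff function, equal to `1` where the relative distance to `F` is at most `δ` and to `0`
where it is at least `2 * δ`. -/
def cutoff (o : M) (δ : ℝ) (F : Finset M) (x : M) : ℝ := unitClamp (2 - relDist o F x / δ)

theorem cutoff_eq_one {δ : ℝ} (hδ : 0 < δ) {F : Finset M} {x : M} (h : relDist o F x ≤ δ) :
    cutoff o δ F x = 1 := by
  refine unitClamp_eq_one ?_
  have := (div_le_one hδ).2 h
  linarith

theorem relDist_lt_of_cutoff_ne_zero {δ : ℝ} (hδ : 0 < δ) {F : Finset M} {x : M}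
    (h : cutoff o δ F x ≠ 0) : relDist o F x < 2 * δ := by
  contrapose! h
  refine unitClamp_eq_zero ?_
  have := (le_div_iff₀ hδ).2 h
  linarith

theorem exists_isMul_cutoff (o : M) {δ : ℝ} (hδ : 0 < δ) (F : Finset M) :
    ∃ L : LipZero M o →L[ℝ] LipZero M o, IsMul L (cutoff o δ F) ∧ ‖L‖ ≤ 1 + 2 / δ := by
  refine exists_isMul (by positivity) (fun x => abs_unitClamp_le_one _) fun x y => ?_
  have h1 : |cutoff o δ F x - cutoff o δ F y| ≤ |relDist o F x - relDist o F y| / δ := by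
    refine (abs_unitClamp_sub_le _ _).trans (le_of_eq ?_)
    rw [sub_sub_sub_cancel_left, ← sub_div, abs_div, abs_of_pos hδ, abs_sub_comm]
  calc dist x o * |cutoff o δ F x - cutoff o δ F y|
      ≤ dist x o * (|relDist o F x - relDist o F y| / δ) :=
        mul_le_mul_of_nonneg_left h1 dist_nonneg
    _ = dist x o * |relDist o F x - relDist o F y| / δ := by ring
    _ ≤ 2 * dist x y / δ := div_le_div_of_nonneg_right (dist_mul_abs_relDist_sub_le o F x y) hδ.le
    _ = 2 / δ * dist x y := by ring

/-! ### Tightness of (V*)-sets -/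

/-- A gliding hump argument: if no finite set works, each failure yields a function vanishing near
the current set and supported near a larger one. -/
theorem exists_cutoff_of_isVStarSet {Γ : Set (LipschitzFree M o)} (hΓ : IsVStarSet Γ)
    {δ ε : ℝ} (hδ : 0 < δ) (hε : 0 < ε) :
    ∃ (F : Finset M) (L : LipZero M o →L[ℝ] LipZero M o), IsMul L (cutoff o δ F) ∧
      ∀ μ ∈ Γ, ∀ f : LipZero M o, |μ.1 f - μ.1 (L f)| ≤ ε * ‖f‖ := by
  classical
  have hδ2 : 0 < δ / 2 := half_pos hδ
  choose H hH hHn using exists_isMul_cutoff o hδ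
  choose K hK hKn using exists_isMul_cutoff o hδ2
  by_contra! hcon
  set C₁ : ℝ := 1 + 2 / δ
  set C₂ : ℝ := 1 + 2 / (δ / 2)
  have hC₁ : 0 ≤ C₁ := by positivity
  have hC₂ : 0 ≤ C₂ := by positivity
  set D : ℝ := C₂ * (1 + C₁)
  have step : ∀ F : Finset M, ∃ (G : Finset M) (g : LipZero M o), F ⊆ G ∧ ‖g‖ ≤ D ∧
      (∀ x, cutoff o δ F x = 1 → g x = 0) ∧ (∀ x, cutoff o (δ / 2) G x = 0 → g x = 0) ∧
      ∃ μ ∈ Γ, ε / 2 ≤ |μ.1 g| := by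
    intro F
    obtain ⟨μ, hμ, f₀, hf₀⟩ := hcon F (H F) (hH F)
    have hne : ‖f₀‖ ≠ 0 := by
      intro h0
      rw [norm_eq_zero] at h0
      simp [h0] at hf₀
    have hpos : 0 < ‖f₀‖ := lt_of_le_of_ne (norm_nonneg _) hne.symm
    obtain ⟨f, hf1, hf⟩ : ∃ f : LipZero M o, ‖f‖ ≤ 1 ∧ ε < |μ.1 (f - H F f)| := by
      refine ⟨‖f₀‖⁻¹ • f₀, ?_, ?_⟩
      · rw [norm_smul, norm_inv, norm_norm, inv_mul_cancel₀ hne]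
      · rw [map_smul, ← smul_sub, map_smul, smul_eq_mul, abs_mul, abs_of_pos (inv_pos.2 hpos),
          map_sub, ← div_eq_inv_mul, lt_div_iff₀ hpos]
        exact hf₀
    set f₁ := f - H F f
    have hf₁ : ∀ x, f₁ x = (1 - cutoff o δ F x) * f x := by
      intro x
      rw [sub_apply, hH F]
      ring
    have hf₁n : ‖f₁‖ ≤ 1 + C₁ := by
      refine (norm_sub_le _ _).trans (add_le_add hf1 ?_)
      refine ((H F).le_opNorm f).trans ?_
      calc ‖H F‖ * ‖f‖ ≤ C₁ * 1 := mul_le_mul (hHn F) hf1 (norm_nonneg _) hC₁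
        _ = C₁ := mul_one _
    set η : ℝ := ε / (2 * ((1 + C₁) + D))
    have hDpos : 0 ≤ D := by positivity
    have hη : 0 < η := by positivity
    obtain ⟨S, ν, hν, hνS⟩ := exists_finset_approx μ hη
    -- Cutting `f₁` off around `S` does not change its values on `S`, so `ν` does not see the change
    -- and `μ` loses at most `ε / 2`.
    refine ⟨F ∪ S, K (F ∪ S) f₁, Finset.subset_union_left, ?_, ?_, ?_, μ, hμ, ?_⟩
    · exact ((K _).le_opNorm f₁).trans
        (mul_le_mul (hKn _) hf₁n (norm_nonneg _) hC₂)
    · intro x hx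
      rw [hK, hf₁, hx, sub_self, zero_mul, mul_zero]
    · intro x hx
      rw [hK, hx, zero_mul]
    · set g := K (F ∪ S) f₁
      have hgn : ‖g‖ ≤ D :=
        ((K _).le_opNorm f₁).trans (mul_le_mul (hKn _) hf₁n (norm_nonneg _) hC₂)
      have h0 : ν (f₁ - g) = 0 := by
        refine hνS _ fun x hx => ?_
        have : cutoff o (δ / 2) (F ∪ S) x = 1 := cutoff_eq_one hδ2 (by
          rw [relDist_eq_zero o (Finset.mem_union_right _ hx)]; exact hδ2.le)
        rw [sub_apply, hK, this, one_mul, sub_self]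
      have h1 : μ.1 f₁ - μ.1 g = (μ.1 - ν) (f₁ - g) := by
        rw [_root_.sub_apply, h0, sub_zero]
        exact (map_sub μ.1 f₁ g).symm
      have h2 : |(μ.1 - ν) (f₁ - g)| ≤ ε / 2 := by
        refine ((μ.1 - ν).le_opNorm _).trans ?_
        calc ‖μ.1 - ν‖ * ‖f₁ - g‖ ≤ η * ((1 + C₁) + D) :=
              mul_le_mul hν.le ((norm_sub_le _ _).trans (add_le_add hf₁n hgn))
                (norm_nonneg _) hη.le
          _ = ε / 2 := by
              have : (1 + C₁) + D ≠ 0 := by positivity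
              simp only [η]
              field_simp
      have h3 : |μ.1 f₁| ≤ |μ.1 g| + |μ.1 f₁ - μ.1 g| := by
        have := abs_add_le (μ.1 g) (μ.1 f₁ - μ.1 g)
        rwa [add_sub_cancel] at this
      rw [h1] at h3
      linarith
  choose G g hFG hgD hg1 hg0 hgμ using step
  let F : ℕ → Finset M := fun n => G^[n] ∅
  have hF : ∀ n, F (n + 1) = G (F n) := fun n => Function.iterate_succ_apply' G n ∅
  have hmono : Monotone F := monotone_nat_of_le_succ fun n => by rw [hF]; exact hFG _
  have hwuc : IsWUC fun n => g (F n) := by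
    refine isWUC_of_disjoint (fun n => hgD (F n)) fun m n x hmn hx => hg1 _ _ ?_
    -- The inner width is halved because a cutoff of width `δ / 2` is supported where the relative
    -- distance is below `δ`, exactly where the next cutoff of width `δ` is `1`.
    have h1 : cutoff o (δ / 2) (F (m + 1)) x ≠ 0 := by
      rw [hF]
      exact fun h => hx (hg0 _ x h)
    have h2 := relDist_lt_of_cutoff_ne_zero hδ2 h1
    refine cutoff_eq_one hδ ((relDist_anti o (hmono (Nat.succ_le_of_lt hmn)) x).trans ?_)
    linarith
  obtain ⟨n, hn⟩ := hΓ.exists_forall_apply_lt hwuc (half_pos hε)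
  obtain ⟨μ, hμ, hle⟩ := hgμ (F n)
  exact absurd (hn μ hμ) (not_lt.2 hle)

theorem exists_seq_isMul_of_isVStarSet {Γ : Set (LipschitzFree M o)} (hΓ : IsVStarSet Γ)
    {δ : ℕ → ℝ} (hδ : ∀ n, 0 < δ n) {ε : ℝ} (hε : 0 < ε) :
    ∃ (F : ℕ → Finset M) (P : ℕ → LipZero M o →L[ℝ] LipZero M o) (p : ℕ → M → ℝ),
      (∀ n, IsMul (P n) (p n)) ∧
      (∀ n x, p n x ≠ 0 → ∀ j < n, relDist o (F j) x < 2 * δ j) ∧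
      ∀ n, ∀ μ ∈ Γ, ∀ f : LipZero M o, |μ.1 f - μ.1 (P n f)| ≤ ε * ‖f‖ := by
  let St := {q : (LipZero M o →L[ℝ] LipZero M o) × (M → ℝ) // IsMul q.1 q.2}
  have step : ∀ (n : ℕ) (q : St), ∃ (F : Finset M) (q' : St), q'.1.2 = q.1.2 * cutoff o (δ n) F ∧
      ∀ μ ∈ Γ, ∀ f : LipZero M o,
        |μ.1 (q.1.1 f) - μ.1 (q'.1.1 f)| ≤ ε / 2 / 2 ^ n * ‖f‖ := by
    intro n q
    -- The reweighted set is again a (V*)-set, so tightness applies to it; the errors `ε / 2 / 2 ^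
    -- n` sum to `ε`.
    obtain ⟨F, L, hL, hb⟩ := exists_cutoff_of_isVStarSet (hΓ.image q.2.weight) (hδ n)
      (show 0 < ε / 2 / 2 ^ n by positivity)
    exact ⟨F, ⟨(q.1.1.comp L, q.1.2 * cutoff o (δ n) F), q.2.comp hL⟩, rfl,
      fun μ hμ f => hb _ ⟨μ, hμ, rfl⟩ f⟩
  choose F q' hq' hb using step
  let q : ℕ → St := fun n => Nat.rec ⟨(ContinuousLinearMap.id ℝ _, 1), IsMul.id⟩ (fun n q => q' n q) n
  have hq : ∀ n, q (n + 1) = q' n (q n) := fun _ => rfl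
  refine ⟨fun n => F n (q n), fun n => (q n).1.1, fun n => (q n).1.2, fun n => (q n).2, ?_, ?_⟩
  · intro n
    induction n with
    | zero => intro x _ j hj; exact absurd hj (Nat.not_lt_zero j)
    | succ n ih =>
      intro x hx j hj
      change (q' n (q n)).1.2 x ≠ 0 at hx
      rw [hq', Pi.mul_apply] at hx
      rcases Nat.lt_succ_iff_lt_or_eq.1 hj with h | rfl
      · exact ih x (left_ne_zero_of_mul hx) j h
      · exact relDist_lt_of_cutoff_ne_zero (hδ j) (right_ne_zero_of_mul hx)
  · intro n μ hμ f
    have h1 : |μ.1 f - μ.1 ((q n).1.1 f)| ≤ ∑ i ∈ Finset.range n, ε / 2 / 2 ^ i * ‖f‖ := by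
      induction n with
      | zero => simp [q]
      | succ n ih =>
        rw [Finset.sum_range_succ]
        have h2 := abs_add_le (μ.1 f - μ.1 ((q n).1.1 f))
          (μ.1 ((q n).1.1 f) - μ.1 ((q (n + 1)).1.1 f))
        rw [sub_add_sub_cancel] at h2
        exact h2.trans (add_le_add ih (hb n (q n) μ hμ f))
    refine h1.trans ?_
    rw [← Finset.sum_mul]
    refine mul_le_mul_of_nonneg_right ?_ (norm_nonneg f)
    exact (summable_geometric_two' ε).sum_le_tsum _ (fun i _ => by positivity) |>.trans
      (tsum_geometric_two' ε).le

/-! ### Convergence of ultrafilters -/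

theorem exists_dist_lt_of_relDist_lt {o : M} {F : Finset M}
    {x : M} {r : ℝ} (h : relDist o F x < r) :
    ∃ y ∈ insert o (F : Set M), dist x y < r * (1 + dist x o) := by
  have h1 : Metric.infDist x (insert o (F : Set M)) < r * (1 + dist x o) :=
    (div_lt_iff₀ (by positivity)).1 h
  exact (Metric.infDist_lt_iff ⟨o, Set.mem_insert _ _⟩).1 h1

/-- The scale `δ 0 ≤ 1 / 2` forces boundedness, after which small relative distance is small
distance. Finitely many small balls then cover a member of `u`, and `u` selects one, so it is
Cauchy. -/
theorem exists_le_nhds_of_relDist_mem [CompleteSpace M] (u : Ultrafilter M) {F : ℕ → Finset M}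
    {δ : ℕ → ℝ} (hδ0 : δ 0 ≤ 1 / 2) (hδ : Tendsto δ atTop (𝓝 0))
    (h : ∀ j, {x | relDist o (F j) x < δ j} ∈ u) : ∃ x, (u : Filter M) ≤ 𝓝 x := by
  have hfin : ∀ j, (insert o (F j : Set M)).Finite := fun j => (F j).finite_toSet.insert o
  obtain ⟨R, hR⟩ := (hfin 0).isBounded.subset_closedBall o
  have hR0 : 0 ≤ R := by simpa using hR (Set.mem_insert o _)
  have hbdd : {x | dist x o ≤ 2 * R + 1} ∈ u := by
    filter_upwards [h 0] with x hx
    obtain ⟨y, hy, hxy⟩ := exists_dist_lt_of_relDist_lt hx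
    have h1 : dist y o ≤ R := hR hy
    have h2 := dist_triangle x y o
    have h3 : δ 0 * (1 + dist x o) ≤ 1 / 2 * (1 + dist x o) :=
      mul_le_mul_of_nonneg_right hδ0 (by positivity)
    change dist x o ≤ 2 * R + 1
    linarith
  refine cauchy_iff_exists_le_nhds.1 (Metric.cauchy_iff.2 ⟨u.neBot, fun ε hε => ?_⟩)
  obtain ⟨j, hj⟩ : ∃ j, δ j * (2 * R + 2) < ε / 2 := by
    have : Tendsto (fun j => δ j * (2 * R + 2)) atTop (𝓝 0) := by
      simpa using hδ.mul_const (2 * R + 2)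
    exact (this.eventually_lt_const (half_pos hε)).exists
  have hmem : (⋃ y ∈ insert o (F j : Set M), Metric.ball y (ε / 2)) ∈ u := by
    filter_upwards [h j, hbdd] with x hx hxb
    obtain ⟨y, hy, hxy⟩ := exists_dist_lt_of_relDist_lt hx
    have hδj : 0 ≤ δ j := (relDist_nonneg o (F j) x).trans (le_of_lt hx)
    have hxb' : dist x o ≤ 2 * R + 1 := hxb
    refine Set.mem_biUnion hy ((hxy.trans_le ?_).trans hj)
    exact mul_le_mul_of_nonneg_left (by linarith) hδj
  obtain ⟨y, -, hy⟩ := (Ultrafilter.finite_biUnion_mem_iff (hfin j)).1 hmem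
  refine ⟨_, hy, fun a ha b hb => ?_⟩
  rw [Metric.mem_ball] at ha hb
  have := dist_triangle_right a b y
  linarith

end LipZero

/-- If the nested sets `A n` do not belong to an ideal, they lie in an ultrafilter that avoids
the ideal. -/
theorem exists_ultrafilter_avoiding {M : Type*} {I : Set M → Prop} (hmono : ∀ A B, I B → A ⊆ B → I A)
    (hempty : I ∅) (hunion : ∀ A B, I A → I B → I (A ∪ B)) {A : ℕ → Set M} (hA : Antitone A)
    (h : ∀ n, ¬ I (A n)) : ∃ u : Ultrafilter M, (∀ n, A n ∈ u) ∧ ∀ B, I B → B ∉ u := by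
  -- The filter generated by the `A n` and the complements of the members of the ideal.
  let l : Filter M :=
    { sets := {B | ∃ n, I (A n \ B)}
      univ_sets := ⟨0, by simpa using hempty⟩
      sets_of_superset := fun ⟨n, hn⟩ hsub => ⟨n, hmono _ _ hn (Set.sdiff_subset_sdiff_right hsub)⟩
      inter_sets := by
        rintro B C ⟨n, hn⟩ ⟨m, hm⟩
        refine ⟨max n m, hmono _ _ (hunion _ _ hn hm) ?_⟩
        rintro x ⟨hx, hxBC⟩
        by_cases hxB : x ∈ B
        · exact .inr ⟨hA (le_max_right n m) hx, fun hxC => hxBC ⟨hxB, hxC⟩⟩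
        · exact .inl ⟨hA (le_max_left n m) hx, hxB⟩ }
  have hl : l.NeBot := by
    refine ⟨fun hbot => ?_⟩
    obtain ⟨n, hn⟩ : ∅ ∈ l := hbot ▸ mem_bot
    exact h n (by simpa using hn)
  refine ⟨Ultrafilter.of l, fun n => Ultrafilter.of_le l ⟨n, by simpa using hempty⟩,
    fun B hB hBu => ?_⟩
  have hc : Bᶜ ∈ Ultrafilter.of l :=
    Ultrafilter.of_le l ⟨0, hmono _ _ hB fun x hx => not_not.1 hx.2⟩
  exact Ultrafilter.compl_mem_iff_notMem.1 hc hBu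

namespace LipZero

open Classical in
/-- Multiplication by `h`, followed by extension by zero, as a linear operation on functions. -/
def mulExtend {M : Type*} (N : Set M) (h : M → ℝ) : (N → ℝ) →ₗ[ℝ] M → ℝ where
  toFun f x := if hx : x ∈ N then h x * f ⟨x, hx⟩ else 0
  map_add' f g := by
    funext x
    by_cases hx : x ∈ N <;> simp [hx, mul_add]
  map_smul' c f := by
    funext x
    by_cases hx : x ∈ N <;> simp [hx, mul_left_comm]

theorem mulExtend_apply_of_mem {M : Type*} {N : Set M} {h : M → ℝ} (f : N → ℝ) {x : M} (hx : x ∈ N) :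
    mulExtend N h f x = h x * f ⟨x, hx⟩ := dif_pos hx

theorem mulExtend_apply_of_notMem {M : Type*} {N : Set M} {h : M → ℝ} (f : N → ℝ) {x : M} (hx : x ∉ N) :
    mulExtend N h f x = 0 := dif_neg hx

variable {M : Type*} [MetricSpace M] {o : M}

/-! ### Sets on which property (V*) is available -/

/-- There is a weighting operator, with weight equal to `1` on `A`, that maps (V*)-sets to
relatively weakly compact sets. -/
def IsVStarLocus (o : M) (A : Set M) : Prop :=
  ∃ (L : LipZero M o →L[ℝ] LipZero M o) (h : M → ℝ) (H : IsMul L h), (∀ x ∈ A, h x = 1) ∧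
    ∀ Γ : Set (LipschitzFree M o), IsVStarSet Γ → IsRelWeaklyCompact (H.weight '' Γ)

theorem IsVStarLocus.mono {A B : Set M} (hB : IsVStarLocus o B) (h : A ⊆ B) :
    IsVStarLocus o A := by
  obtain ⟨L, w, H, h1, h2⟩ := hB
  exact ⟨L, w, H, fun x hx => h1 x (h hx), h2⟩

theorem IsVStarLocus.empty : IsVStarLocus o (∅ : Set M) := by
  refine ⟨0, 0, IsMul.zero, fun x hx => hx.elim, fun Γ _ => ?_⟩
  refine .of_subset_isCompact (isCompact_singleton (x := 0)) ?_
  rintro _ ⟨_, ⟨μ, -, rfl⟩, rfl⟩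
  have : (IsMul.zero : IsMul (0 : LipZero M o →L[ℝ] LipZero M o) 0).weight μ = 0 :=
    Subtype.ext (ContinuousLinearMap.ext fun f => map_zero μ.1)
  rw [this, map_zero]
  rfl

/-- The weight `w₁ + w₂ * (1 - w₁)` is `1` wherever `w₁` or `w₂` is. -/
theorem IsVStarLocus.union {A B : Set M} (hA : IsVStarLocus o A) (hB : IsVStarLocus o B) :
    IsVStarLocus o (A ∪ B) := by
  obtain ⟨L₁, w₁, H₁, h₁, hc₁⟩ := hA
  obtain ⟨L₂, w₂, H₂, h₂, hc₂⟩ := hB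
  have H₃ := IsMul.id.sub H₁
  refine ⟨_, _, H₁.add (H₂.comp H₃), ?_, fun Γ hΓ => ?_⟩
  · intro x hx
    simp only [Pi.add_apply, Pi.mul_apply, Pi.sub_apply, Pi.one_apply]
    rcases hx with hx | hx
    · rw [h₁ x hx]; ring
    · rw [h₂ x hx]; ring
  · refine .of_forall_add (hc₁ Γ hΓ) ((hc₂ Γ hΓ).image H₃.weight) ?_
    rintro _ ⟨μ, hμ, rfl⟩
    refine ⟨_, ⟨μ, hμ, rfl⟩, _, ⟨_, ⟨μ, hμ, rfl⟩, rfl⟩, ?_⟩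
    exact Subtype.ext (ContinuousLinearMap.ext fun f => map_add μ.1 _ _)

/-! ### Factoring weights through a subset -/

section Local

variable {N : Set M} (ho : o ∈ N)

/-- Restriction of Lipschitz functions to a subset. -/
def restrict : LipZero M o →L[ℝ] LipZero N ⟨o, ho⟩ :=
  mkOperator (LinearMap.funLeft ℝ ℝ Subtype.val) 1 zero_le_one
    (fun f x y => by rw [one_mul]; exact abs_sub_le f x y) fun f => map_base f

theorem exists_extension (f : LipZero N ⟨o, ho⟩) :
    ∃ g : LipZero M o, (∀ x : N, g x = f x) ∧ ‖g‖ ≤ ‖f‖ := by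
  classical
  let f' : M → ℝ := fun x => if hx : x ∈ N then f ⟨x, hx⟩ else 0
  have hf' : ∀ x : N, f' x = f x := fun x => dif_pos x.2
  have hlip : LipschitzOnWith ‖f‖₊ f' N := LipschitzOnWith.of_dist_le_mul fun x hx y hy => by
    rw [Real.dist_eq, hf' ⟨x, hx⟩, hf' ⟨y, hy⟩]
    exact abs_sub_le f ⟨x, hx⟩ ⟨y, hy⟩
  obtain ⟨g, hg, hgf⟩ := hlip.extend_real
  have hgN : ∀ x : N, g x = f x := fun x => (hgf x.2).symm.trans (hf' x)
  have hb : ∀ x y, |g x - g y| ≤ ‖f‖ * dist x y := fun x y => by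
    simpa [Real.dist_eq] using hg.dist_le_mul x y
  exact ⟨ofLipschitz g ‖f‖ hb ((hgN ⟨o, ho⟩).trans (map_base f)), hgN,
    norm_le_of (norm_nonneg f) hb⟩

/-- The weight factors as `F(M) → F(N) → F(M)`, and property (V*) is used in the middle. The first
map is preadjoint to multiplication by `h` with extension by zero, which is bounded because a
norm-preserving extension of `f` may replace `f`. -/
theorem isRelWeaklyCompact_weight_of_support_subset {h : M → ℝ} {C : ℝ} (hC : 0 ≤ C)
    (h1 : ∀ x, |h x| ≤ 1) (hh : ∀ x y, dist x o * |h x - h y| ≤ C * dist x y)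
    (hN : ∀ x, h x ≠ 0 → x ∈ N) (hV : HasPropertyVStar (LipschitzFree N ⟨o, ho⟩)) :
    ∃ (L : LipZero M o →L[ℝ] LipZero M o) (H : IsMul L h), ∀ Γ : Set (LipschitzFree M o),
      IsVStarSet Γ → IsRelWeaklyCompact (H.weight '' Γ) := by
  have hmul : ∀ (f : N → ℝ) (g : M → ℝ), (∀ x : N, g x = f x) →
      ∀ x, mulExtend N h f x = h x * g x := by
    intro f g hg x
    by_cases hx : x ∈ N
    · rw [mulExtend_apply_of_mem f hx, hg ⟨x, hx⟩]
    · rw [mulExtend_apply_of_notMem f hx, not_not.1 (mt (hN x) hx), zero_mul]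
  let E : LipZero N ⟨o, ho⟩ →L[ℝ] LipZero M o :=
    mkOperator (mulExtend N h) (1 + C) (by positivity) (fun f x y => by
      obtain ⟨g, hg, hgn⟩ := exists_extension ho f
      rw [hmul f g hg, hmul f g hg]
      refine (abs_mul_sub_mul_le h1 hh g x y).trans ?_
      gcongr) fun f => by
        rw [mulExtend_apply_of_mem _ ho]
        exact mul_eq_zero_of_right _ (map_base f)
  have hE : ∀ x, (delta o x).comp E ∈ freeSubmodule N ⟨o, ho⟩ := by
    intro x
    by_cases hx : x ∈ N
    · have : (delta o x).comp E = h x • delta (⟨o, ho⟩ : N) ⟨x, hx⟩ :=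
        ContinuousLinearMap.ext fun f => mulExtend_apply_of_mem f hx
      rw [this]
      exact Submodule.smul_mem _ _ (delta_mem_freeSubmodule _ _)
    · have : (delta o x).comp E = 0 :=
        ContinuousLinearMap.ext fun f => mulExtend_apply_of_notMem f hx
      rw [this]
      exact Submodule.zero_mem _
  have hR : ∀ x, (delta (⟨o, ho⟩ : N) x).comp (restrict ho) ∈ freeSubmodule M o :=
    fun x => delta_mem_freeSubmodule o x.1
  have H : IsMul (E.comp (restrict ho)) h := fun f x => hmul _ f (fun _ => rfl) x
  refine ⟨_, H, fun Γ hΓ => ?_⟩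
  have h2 := IsRelWeaklyCompact.image (Y := LipschitzFree M o)
    (hV _ (hΓ.image (preadjoint E hE))) (preadjoint (restrict ho) hR)
  rw [Set.image_image] at h2
  exact h2

end Local

theorem isVStarLocus_ball {a : M} {r : ℝ} (hr : 0 < r) {N : Set M} (ho : o ∈ N)
    (hN : Metric.ball a (2 * r) ⊆ N) (hV : HasPropertyVStar (LipschitzFree N ⟨o, ho⟩)) :
    IsVStarLocus o (Metric.ball a r) := by
  set h : M → ℝ := fun x => unitClamp (2 - dist x a / r)
  have hsupp : ∀ x, h x ≠ 0 → x ∈ Metric.ball a (2 * r) := by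
    intro x hx
    rw [Metric.mem_ball]
    contrapose! hx
    refine unitClamp_eq_zero ?_
    have := (le_div_iff₀ hr).2 hx
    linarith
  have hone : ∀ x ∈ Metric.ball a r, h x = 1 := by
    intro x hx
    refine unitClamp_eq_one ?_
    have := (div_le_one hr).2 (le_of_lt (Metric.mem_ball.1 hx))
    linarith
  have hlip : ∀ x y, |h x - h y| ≤ dist x y / r := by
    intro x y
    refine (abs_unitClamp_sub_le _ _).trans ?_
    rw [sub_sub_sub_cancel_left, ← sub_div, abs_div, abs_of_pos hr, dist_comm x y]
    exact div_le_div_of_nonneg_right (abs_dist_sub_le y x a) hr.le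
  have hle : ∀ x y, |h x - h y| ≤ 1 := by
    intro x y
    rw [abs_le]
    constructor <;>
      linarith [unitClamp_nonneg (2 - dist x a / r), unitClamp_le_one (2 - dist x a / r),
        unitClamp_nonneg (2 - dist y a / r), unitClamp_le_one (2 - dist y a / r)]
  set R : ℝ := 2 * r + dist a o
  have hR : ∀ x, h x ≠ 0 → dist x o ≤ R := by
    intro x hx
    have h1 := Metric.mem_ball.1 (hsupp x hx)
    have h2 := dist_triangle x a o
    change dist x o ≤ 2 * r + dist a o
    linarith
  have hR0 : 0 ≤ R := by positivity
  have hbound : ∀ x y, dist x o * |h x - h y| ≤ (R / r + 1) * dist x y := by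
    intro x y
    have hd : (0 : ℝ) ≤ dist x y := dist_nonneg
    have h2 : R * |h x - h y| ≤ R / r * dist x y :=
      (mul_le_mul_of_nonneg_left (hlip x y) hR0).trans (le_of_eq (by ring))
    have h3 : dist x y * |h x - h y| ≤ dist x y :=
      mul_le_of_le_one_right hd (hle x y)
    by_cases hxy : h x = 0 ∧ h y = 0
    · rw [hxy.1, hxy.2, sub_self, abs_zero, mul_zero]
      positivity
    -- If only `y` is in the support, `x` may be far from `o`; the excess `dist x y` is absorbed by
    -- `|h x - h y| ≤ 1`.
    · have h4 : dist x o ≤ R + dist x y := by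
        by_cases hx : h x = 0
        · have h5 := hR y fun hy => hxy ⟨hx, hy⟩
          have h6 := dist_triangle x y o
          linarith
        · linarith [hR x hx]
      have h5 := mul_le_mul_of_nonneg_right h4 (abs_nonneg (h x - h y))
      linarith
  obtain ⟨L, H, hL⟩ := isRelWeaklyCompact_weight_of_support_subset ho (by positivity)
    (fun x => abs_unitClamp_le_one _) hbound (fun x hx => hN (hsupp x hx)) hV
  exact ⟨L, h, H, hone, hL⟩

end LipZero

end

/-! ### From tightness and local weights to weak compactness -/

open LipZero in
theorem theoremA {M : Type*} [MetricSpace M] [CompleteSpace M] (o : M)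
    (h : ∀ x : M, ∃ U ∈ 𝓝 x,
      HasPropertyVStar (LipschitzFree ↥(closure U ∪ {o}) ⟨o, Or.inr rfl⟩)) :
    HasPropertyVStar (LipschitzFree M o) := by
  have hlocal : ∀ x : M, ∃ B ∈ 𝓝 x, IsVStarLocus o B := by
    intro x
    obtain ⟨U, hU, hV⟩ := h x
    obtain ⟨r, hr, hrU⟩ := Metric.mem_nhds_iff.1 hU
    refine ⟨_, Metric.ball_mem_nhds x (half_pos hr), isVStarLocus_ball (half_pos hr) _ ?_ hV⟩
    rw [mul_div_cancel₀ r two_ne_zero]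
    exact hrU.trans (subset_closure.trans Set.subset_union_left)
  intro Γ hΓ
  have : CompleteSpace (LipschitzFree M o) :=
    (Submodule.isClosed_topologicalClosure _).completeSpace_coe
  refine .of_approx fun ε hε => ?_
  -- The factor `1 / 4` makes the first radius `2 * δ 0` equal to `1 / 2`, as convergence of the
  -- ultrafilter requires.
  set δ : ℕ → ℝ := fun n => 1 / 4 * (1 / ((n : ℝ) + 1))
  obtain ⟨F, P, p, hP, hsupp, happ⟩ := exists_seq_isMul_of_isVStarSet hΓ
    (δ := δ) (fun n => by positivity) hε
  let A : ℕ → Set M := fun n => {x | ∀ j < n, relDist o (F j) x < 2 * δ j}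
  obtain ⟨n, L, w, H, hw, hL⟩ : ∃ n, IsVStarLocus o (A n) := by
    by_contra! hcon
    obtain ⟨u, hu, huI⟩ := exists_ultrafilter_avoiding (fun _ _ hB hAB => hB.mono hAB)
      IsVStarLocus.empty (fun _ _ hA hB => hA.union hB)
      (A := A) (fun m n hmn x hx j hj => hx j (hj.trans_le hmn)) hcon
    have hδ : Tendsto (fun j => 2 * δ j) atTop (𝓝 0) := by
      have := ((tendsto_one_div_add_atTop_nhds_zero_nat (𝕜 := ℝ)).const_mul (1 / 4)).const_mul 2
      rwa [mul_zero, mul_zero] at this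
    obtain ⟨x, hx⟩ := exists_le_nhds_of_relDist_mem u (F := F) (δ := fun j => 2 * δ j)
      (by norm_num [δ]) hδ fun j => mem_of_superset (hu (j + 1)) fun x hx => hx j (Nat.lt_succ_self j)
    obtain ⟨B, hB, hBI⟩ := hlocal x
    exact huI B hBI (hx hB)
  refine ⟨_, (hL Γ hΓ).image (hP n).weight, fun μ hμ => ⟨_, ⟨_, ⟨μ, hμ, rfl⟩, rfl⟩, ?_⟩⟩
  refine ContinuousLinearMap.opNorm_le_bound _ hε.le fun f => ?_
  -- The weight `p n` is supported in `A n`, where `w = 1`; hence weighting by `w` first changes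
  -- nothing.
  have hLP : L (P n f) = P n f := by
    refine DFunLike.ext _ _ fun x => ?_
    rw [H]
    by_cases hx : p n x = 0
    · rw [hP n, hx, zero_mul, mul_zero]
    · rw [hw x (hsupp n x hx), one_mul]
  have h1 := happ n μ hμ f
  rw [← hLP] at h1
  exact h1
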